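/- Let $d\ge 1$ and $\lambda>0$. Let $H=\{(x,y):x\in\mathbb{R}^d,\ y>0\}$ be the half-space model of the hyperbolic space $\mathbb{H}^{d+1}$, with metric $ds^2=(dx_1^2+\dots+dx_d^2+dy^2)/y^2$, hyperbolic distance $d(\cdot,\cdot)$ and hyperbolic volume $dx\,dy/y^{d+1}$. Let $\mathcal{N}$ be a homogeneous Poisson point process of intensity $\lambda$ on $H$ with respect to the hyperbolic volume. For $h\ge 0$ put $O(h)=(0,e^h)$. For $z=(x,y)\in\mathcal{N}$ define: - $A_{\mathrm{RST}(h)}(z)$, the parent of $z$ in the radial spanning tree $\mathrm{RST}(h)$ of $\mathcal{N}$ with origin $O(h)$, as the closest point to $z$, for $d$, among the points $z'\in\mathcal{N}\cup\{O(h)\}$ with $d(O(h),z')<d(O(h),z)$; - $A_{\mathrm{DSF}}(z)$, the parent of $z$ in the hyperbolic directed spanning forest (DSF) of $\mathcal{N}$ with direction $\infty$, as the closest point to $z$, for $d$, among the points $z'=(x',y')\in\mathcal{N}$ with $y'>y$. (For each $h$, these are almost surely well defined for all $z\in\mathcal{N}$.) Then for every compact set $K\subset H$, $$\lim_{h\to\infty}\mathbb{P}\big[\forall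 z\in\mathcal{N}\cap K,\ A_{\mathrm{RST}(h)}(z)=A_{\mathrm{DSF}}(z)\big]=1.$$ -/

import Mathlib

open MeasureTheory ProbabilityTheory Filter Topology

/-- The upper half-space model of `(d+1)`-dimensional hyperbolic space: the points `(x, y)` with
`x ∈ ℝ^d` and `y > 0`. It carries the subspace topology, which is the topology of the
hyperbolic metric, and its Borel σ-algebra. -/
abbrev HalfSpace (d : ℕ) : Type := {p : EuclideanSpace ℝ (Fin d) × ℝ // 0 < p.2}

namespace HalfSpace

/-- The abscissa `x ∈ ℝ^d` of the point `(x, y)`. -/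
def abscissa {d : ℕ} (z : HalfSpace d) : EuclideanSpace ℝ (Fin d) := z.1.1

/-- The ordinate `y > 0` of the point `(x, y)`. -/
def ordinate {d : ℕ} (z : HalfSpace d) : ℝ := z.1.2

/-- The hyperbolic distance, that is the Riemannian distance of the metric
`(dx₁² + ⋯ + dx_d² + dy²) / y²`; same closed form as for `UpperHalfPlane` in Mathlib.
(The metric that `HalfSpace d` inherits as a subtype is never used.) -/
noncomputable def hypDist {d : ℕ} (z w : HalfSpace d) : ℝ :=
  2 * Real.arsinh (√(‖z.abscissa - w.abscissa‖ ^ 2 + (z.ordinate - w.ordinate) ^ 2) /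
    (2 * √(z.ordinate * w.ordinate)))

/-- The hyperbolic volume `dx dy / y ^ (d + 1)`. -/
noncomputable def hypVol (d : ℕ) : Measure (HalfSpace d) :=
  (Measure.comap Subtype.val (volume : Measure (EuclideanSpace ℝ (Fin d) × ℝ))).withDensity
    (fun z : HalfSpace d => ENNReal.ofReal (1 / z.ordinate ^ (d + 1)))

/-- The open hyperbolic ball of centre `c` and radius `r`. -/
def hypBall {d : ℕ} (c : HalfSpace d) (r : ℝ) : Set (HalfSpace d) := {z | hypDist c z < r}

/-- The point `O(h) = (0, e^h)`. -/
noncomputable def originAt (d : ℕ) (h : ℝ) : HalfSpace d := ⟨(0, Real.exp h), Real.exp_pos h⟩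

/-- `w` is the closest point to `z` in `S`, i.e. the unique minimiser over `z' ∈ S` of the
hyperbolic distance from `z` to `z'`. -/
def IsClosestIn {d : ℕ} (S : Set (HalfSpace d)) (z w : HalfSpace d) : Prop :=
  w ∈ S ∧ ∀ z' ∈ S, z' ≠ w → hypDist z w < hypDist z z'

/-- `w` is the parent of `z` in the radial spanning tree of the point set `N` with origin `O`:
the closest point to `z` among the points of `N ∪ {O}` that are strictly closer to `O` than `z`. -/
def IsRSTParent {d : ℕ} (N : Set (HalfSpace d)) (O z w : HalfSpace d) : Prop :=
  IsClosestIn ((N ∪ {O}) ∩ hypBall O (hypDist O z)) z w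

/-- `w` is the parent of `z` in the directed spanning forest of the point set `N` with direction
the boundary point `∞`: the closest point to `z` among the points of `N` of strictly greater
ordinate than `z`. -/
def IsDSFParent {d : ℕ} (N : Set (HalfSpace d)) (z w : HalfSpace d) : Prop :=
  IsClosestIn {z' ∈ N | z.ordinate < z'.ordinate} z w

end HalfSpace

/-- The random set `N` of points of `X` is a Poisson point process of intensity measure `μ`: the
number of points in each measurable set is a random variable, it has the Poisson law of parameter
`μ B` for each measurable `B` of finite measure, and the numbers of points in finitely many
pairwise disjoint measurable sets are independent. -/
structure IsPoissonPointProcess {Ω X : Type*} [MeasurableSpace Ω] [MeasurableSpace X]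
    (N : Ω → Set X) (μ : Measure X) (P : Measure Ω) : Prop where
  measurable_count : ∀ B : Set X, MeasurableSet B → Measurable (fun ω => (N ω ∩ B).encard)
  poisson_count : ∀ B : Set X, MeasurableSet B → μ B ≠ ⊤ →
    P.map (fun ω => (N ω ∩ B).encard) =
      (poissonMeasure (μ B).toNNReal).map (fun n : ℕ => (n : ℕ∞))
  indep_count : ∀ (n : ℕ) (B : Fin n → Set X), (∀ i, MeasurableSet (B i)) →
    Pairwise (fun i j => Disjoint (B i) (B j)) →
    iIndepFun (fun i ω => (N ω ∩ B i).encard) P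

/-- The event that every point of `N` in `K` has a well-defined parent in the radial spanning tree
`RST(h)` with origin `O(h)` and in the directed spanning forest, and that the two coincide. -/
def sameParents {Ω : Type*} {d : ℕ} (N : Ω → Set (HalfSpace d)) (K : Set (HalfSpace d)) (h : ℝ) :
    Set Ω :=
  {ω | ∀ z ∈ N ω ∩ K, ∃ w : HalfSpace d,
    HalfSpace.IsRSTParent (N ω) (HalfSpace.originAt d h) z w ∧ HalfSpace.IsDSFParent (N ω) z w}

/-!
The argument compares the two parent searches inside one compact box `L`.

Balls centred at `O(h) = (0, e^h)` converge to horoballs: inside a box, the ball of centre `O(h)`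
with `z` on its boundary and the half-space above `z` differ only at points whose ordinate is within
`δ` of that of `z`, once `h` is large (`HalfSpace.eventually_distRatio_originAt_lt`). So if no point
of the process other than `z` has an ordinate that close, both searches see the same candidates in
`L`. If moreover the process has a point `u` above `z` such that all points closer to `z` than `u`
lie in `L`, and if no two points of the process in `L` are equidistant from `z`, then both searches
have the same unique minimiser (`HalfSpace.exists_common_parent`).

It remains to bound the probability that one of these conditions fails, uniformly in `h`.
* A horizontal slab above `K` has infinite volume, so a large box in it contains a point `u` with
  probability close to `1` (`exists_measure_box_empty_le`); this box and a bound on its distance to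
  `K` determine `L`.
* Near-coincidences of ordinates and exact equidistances are controlled by a first moment bound
  (`IsPoissonPointProcess.measure_exists_tuple_le`): some `k` distinct points of the process form a
  tuple of a closed set `F` with probability at most the mass of `F` for the `k`-th power of the
  intensity. It follows from the independence of the counts in the cells of a fine partition, two
  points falling into a common cell with vanishing probability because the intensity has no atoms.
  The relevant sets `F` are null, or nearly so, because level sets of the ordinate and hyperbolic
  spheres are null for the hyperbolic volume.

The event in question is not known to be measurable, so all bounds concern the outer measure of its
complement.
-/

/-! ### Counts of a Poisson point process -/

namespace IsPoissonPointProcess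

variable {Ω X : Type*} [MeasurableSpace Ω] [MeasurableSpace X] {N : Ω → Set X} {μ : Measure X}
  {P : Measure Ω}

lemma measure_encard_mem (hN : IsPoissonPointProcess N μ P) {B : Set X} (hB : MeasurableSet B)
    (hμ : μ B ≠ ⊤) (S : Set ℕ∞) :
    P {ω | (N ω ∩ B).encard ∈ S} = poissonMeasure (μ B).toNNReal {n : ℕ | (n : ℕ∞) ∈ S} := by
  have hS : MeasurableSet S := S.to_countable.measurableSet
  have h := congrArg (fun m : Measure ℕ∞ => m S) (hN.poisson_count B hB hμ)
  simp only [Measure.map_apply (hN.measurable_count B hB) hS] at h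
  rw [Measure.map_apply .of_discrete hS] at h
  exact h

lemma measure_encard_eq_zero (hN : IsPoissonPointProcess N μ P) {B : Set X}
    (hB : MeasurableSet B) (hμ : μ B ≠ ⊤) :
    P {ω | (N ω ∩ B).encard = 0} = ENNReal.ofReal (Real.exp (-(μ B).toReal)) := by
  have h := hN.measure_encard_mem hB hμ {0}
  have h0 : {n : ℕ | (n : ℕ∞) ∈ ({0} : Set ℕ∞)} = {0} := by ext; simp
  rw [h0, poissonMeasure_singleton, ENNReal.coe_toNNReal_eq_toReal] at h
  simpa using h

lemma measure_encard_eq_top (hN : IsPoissonPointProcess N μ P) {B : Set X}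
    (hB : MeasurableSet B) (hμ : μ B ≠ ⊤) :
    P {ω | (N ω ∩ B).encard = ⊤} = 0 := by
  have h := hN.measure_encard_mem hB hμ {⊤}
  have h0 : {n : ℕ | (n : ℕ∞) ∈ ({⊤} : Set ℕ∞)} = ∅ := by ext; simp
  rw [h0] at h
  simpa using h

lemma measure_one_le_encard_le (hN : IsPoissonPointProcess N μ P) {B : Set X}
    (hB : MeasurableSet B) (hμ : μ B ≠ ⊤) :
    P {ω | 1 ≤ (N ω ∩ B).encard} ≤ μ B := by
  have h := hN.measure_encard_mem hB hμ (Set.Ici 1)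
  have h0 : {n : ℕ | (n : ℕ∞) ∈ Set.Ici (1 : ℕ∞)} = {0}ᶜ := by
    ext n; simp [Nat.one_le_iff_ne_zero]
  rw [h0, prob_compl_eq_one_sub .of_discrete, poissonMeasure_singleton] at h
  refine h.trans_le ?_
  have hm := Real.add_one_le_exp (-(μ B).toReal)
  rw [← ENNReal.ofReal_toReal hμ, ← ENNReal.ofReal_one, ← ENNReal.ofReal_sub _ (by positivity)]
  apply ENNReal.ofReal_le_ofReal
  simp only [ENNReal.toReal_ofReal ENNReal.toReal_nonneg, ENNReal.coe_toNNReal_eq_toReal]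
  simp
  linarith

lemma measure_two_le_encard_le (hN : IsPoissonPointProcess N μ P) {B : Set X}
    (hB : MeasurableSet B) (hμ : μ B ≠ ⊤) :
    P {ω | 2 ≤ (N ω ∩ B).encard} ≤ μ B * μ B := by
  have h := hN.measure_encard_mem hB hμ (Set.Ici 2)
  have h0 : {n : ℕ | (n : ℕ∞) ∈ Set.Ici (2 : ℕ∞)} = ({0} ∪ {1})ᶜ := by
    ext n
    simp only [Set.mem_Ici, Set.mem_compl_iff, Set.mem_union, Set.mem_singleton_iff,
      Set.mem_ofPred_eq]
    rw [show (2 : ℕ∞) = ((2 : ℕ) : ℕ∞) from rfl, Nat.cast_le]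
    lia
  rw [h0, prob_compl_eq_one_sub .of_discrete, measure_union (by simp) .of_discrete,
    poissonMeasure_singleton, poissonMeasure_singleton] at h
  refine h.trans_le ?_
  have hm := Real.add_one_le_exp (-(μ B).toReal)
  have hpos : 0 ≤ (μ B).toReal := ENNReal.toReal_nonneg
  rw [← ENNReal.ofReal_toReal hμ, ← ENNReal.ofReal_one, ← ENNReal.ofReal_add (by positivity)
    (by positivity), ← ENNReal.ofReal_sub _ (by positivity), ← ENNReal.ofReal_mul hpos]
  apply ENNReal.ofReal_le_ofReal
  simp only [ENNReal.toReal_ofReal ENNReal.toReal_nonneg, ENNReal.coe_toNNReal_eq_toReal]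
  simp
  nlinarith [mul_le_mul_of_nonneg_right hm (by linarith : (0 : ℝ) ≤ 1 + (μ B).toReal)]

lemma measure_forall_one_le_encard_le (hN : IsPoissonPointProcess N μ P) {k : ℕ}
    {B : Fin k → Set X} (hB : ∀ i, MeasurableSet (B i)) (hμ : ∀ i, μ (B i) ≠ ⊤)
    (hd : Pairwise fun i j => Disjoint (B i) (B j)) :
    P {ω | ∀ i, 1 ≤ (N ω ∩ B i).encard} ≤ ∏ i, μ (B i) := by
  have h := (hN.indep_count k B hB hd).meas_iInter
    (s := fun i => {ω | 1 ≤ (N ω ∩ B i).encard})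
    fun i => ⟨Set.Ici 1, (Set.Ici (1 : ℕ∞)).to_countable.measurableSet, rfl⟩
  rw [← Set.ofPred_forall] at h
  rw [h]
  exact Finset.prod_le_prod' fun i _ => hN.measure_one_le_encard_le (hB i) (hμ i)

end IsPoissonPointProcess

/-! ### First moment bound for tuples of points -/

/-- A separable metric space splits into countably many measurable cells of small diameter: the
fibres of `g`. -/
lemma exists_measurable_nat_dist_lt (X : Type*) [PseudoMetricSpace X]
    [TopologicalSpace.SeparableSpace X] [MeasurableSpace X] [OpensMeasurableSpace X] {r : ℝ}
    (hr : 0 < r) :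
    ∃ g : X → ℕ, Measurable g ∧ ∀ x y, g x = g y → dist x y < r := by
  classical
  rcases isEmpty_or_nonempty X with hX | hX
  · exact ⟨fun _ => 0, measurable_const, fun x => isEmptyElim x⟩
  have hp : ∀ x : X, ∃ n, dist x (TopologicalSpace.denseSeq X n) < r / 2 := fun x =>
    (TopologicalSpace.denseRange_denseSeq X).exists_dist_lt x (half_pos hr)
  refine ⟨fun x => Nat.find (hp x), measurable_find hp fun n => ?_, fun x y hxy => ?_⟩
  · exact (isOpen_lt (by fun_prop) continuous_const).measurableSet
  · have hx := Nat.find_spec (hp x)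
    have hy := Nat.find_spec (hp y)
    have hxy : Nat.find (hp x) = Nat.find (hp y) := hxy
    rw [← hxy] at hy
    linarith [dist_triangle_right x y (TopologicalSpace.denseSeq X (Nat.find (hp x)))]

/-- The `r`-neighbourhoods of the diagonal lose all their mass for an atomless measure. -/
lemma tendsto_measure_cthickening_diagonal {X : Type*} [MetricSpace X] [SecondCountableTopology X]
    [MeasurableSpace X] [BorelSpace X] (ν : Measure X) [IsFiniteMeasure ν] [NullSingletonClass ν] :
    Tendsto (fun r => (ν.prod ν) (Metric.cthickening r (Set.diagonal X))) (𝓝 0) (𝓝 0) := by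
  have h := tendsto_measure_cthickening_of_isClosed (μ := ν.prod ν) (s := Set.diagonal X)
    ⟨1, one_pos, measure_ne_top _ _⟩ isClosed_diagonal
  rwa [(Measure.measure_prod_null isClosed_diagonal.measurableSet).2] at h
  refine Eventually.of_forall fun x => ?_
  have : Prod.mk x ⁻¹' Set.diagonal X = {x} := by ext y; simp [eq_comm]
  simp [this]

namespace IsPoissonPointProcess

variable {Ω X : Type*} [MeasurableSpace Ω] [MetricSpace X] [SecondCountableTopology X]
  [MeasurableSpace X] [BorelSpace X] {N : Ω → Set X} {μ : Measure X} {P : Measure Ω}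

/-- The first moment bound up to an error depending on a mesh `r`: either all points of the tuple
lie in distinct cells, and then the counts of these cells are independent, or some cell holds two
points of the process. -/
lemma measure_exists_tuple_le_cthickening (hN : IsPoissonPointProcess N μ P) {L : Set X}
    (hL : MeasurableSet L) (hμL : μ L ≠ ⊤) {k : ℕ} (F : Set (Fin k → X)) {r : ℝ} (hr : 0 < r) :
    P {ω | ∃ z : Fin k → X, z.Injective ∧ (∀ i, z i ∈ N ω ∩ L) ∧ z ∈ F} ≤
      ((μ.restrict L).prod (μ.restrict L)) (Metric.cthickening r (Set.diagonal X)) +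
        Measure.pi (fun _ => μ.restrict L) (Metric.cthickening r F) := by
  have : IsFiniteMeasure (μ.restrict L) := isFiniteMeasure_restrict.2 hμL
  obtain ⟨g, hg, hgr⟩ := exists_measurable_nat_dist_lt X hr
  set ν := μ.restrict L with hν
  have hcell : ∀ i, MeasurableSet (g ⁻¹' {i}) := fun i => hg (measurableSet_singleton i)
  have hcellL : ∀ i, MeasurableSet (g ⁻¹' {i} ∩ L) := fun i => (hcell i).inter hL
  have hνcell : ∀ i, ν (g ⁻¹' {i}) = μ (g ⁻¹' {i} ∩ L) := fun i => Measure.restrict_apply (hcell i)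
  have hfin : ∀ i, μ (g ⁻¹' {i} ∩ L) ≠ ⊤ := fun i => hνcell i ▸ measure_ne_top ν _
  have hdisj : ∀ i j, i ≠ j → Disjoint (g ⁻¹' {i}) (g ⁻¹' {j}) := fun i j hij =>
    Disjoint.preimage g (by simpa using hij)
  let Bad : Set (Fin k → ℕ) := {c | c.Injective ∧ ∃ z ∈ F, ∀ i, g (z i) = c i}
  have hsub : {ω | ∃ z : Fin k → X, z.Injective ∧ (∀ i, z i ∈ N ω ∩ L) ∧ z ∈ F} ⊆
      (⋃ i, {ω | 2 ≤ (N ω ∩ (g ⁻¹' {i} ∩ L)).encard}) ∪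
        ⋃ c : Bad, {ω | ∀ i, 1 ≤ (N ω ∩ (g ⁻¹' {c.1 i} ∩ L)).encard} := by
    rintro ω ⟨z, hz, hzN, hzF⟩
    by_cases hinj : Function.Injective fun i => g (z i)
    · refine Or.inr (Set.mem_iUnion.2 ⟨⟨_, hinj, z, hzF, fun i => rfl⟩, fun i => ?_⟩)
      exact Set.one_le_encard_iff_nonempty.2 ⟨z i, (hzN i).1, rfl, (hzN i).2⟩
    · simp only [Function.Injective, not_forall] at hinj
      obtain ⟨i, j, hij, hne⟩ := hinj
      refine Or.inl (Set.mem_iUnion.2 ⟨g (z i), ?_⟩)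
      have : 1 < (N ω ∩ (g ⁻¹' {g (z i)} ∩ L)).encard := Set.one_lt_encard_iff.2
        ⟨z i, z j, ⟨(hzN i).1, rfl, (hzN i).2⟩, ⟨(hzN j).1, hij.symm, (hzN j).2⟩,
          fun h => hne (hz h)⟩
      exact Order.add_one_le_of_lt this
  refine (measure_mono hsub).trans ((measure_union_le _ _).trans (add_le_add ?_ ?_))
  · calc P (⋃ i, {ω | 2 ≤ (N ω ∩ (g ⁻¹' {i} ∩ L)).encard})
        ≤ ∑' i, P {ω | 2 ≤ (N ω ∩ (g ⁻¹' {i} ∩ L)).encard} := measure_iUnion_le _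
      _ ≤ ∑' i, (ν.prod ν) ((g ⁻¹' {i}) ×ˢ (g ⁻¹' {i})) := by
        refine ENNReal.tsum_le_tsum fun i => ?_
        rw [Measure.prod_prod, hνcell]
        exact hN.measure_two_le_encard_le (hcellL i) (hfin i)
      _ = (ν.prod ν) (⋃ i, (g ⁻¹' {i}) ×ˢ (g ⁻¹' {i})) := by
        refine (measure_iUnion (fun i j hij => ?_) fun i => (hcell i).prod (hcell i)).symm
        exact Set.disjoint_prod.2 (Or.inl (hdisj i j hij))
      _ ≤ _ := by
        refine measure_mono (Set.iUnion_subset fun i p hp => ?_)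
        have hp1 : g p.1 = i := hp.1
        have hp2 : g p.2 = i := hp.2
        refine Metric.mem_cthickening_of_dist_le p (p.1, p.1) r _ rfl ?_
        rw [Prod.dist_eq, dist_self, max_eq_right dist_nonneg]
        exact (hgr _ _ (hp2.trans hp1.symm)).le
  · calc P (⋃ c : Bad, {ω | ∀ i, 1 ≤ (N ω ∩ (g ⁻¹' {c.1 i} ∩ L)).encard})
        ≤ ∑' c : Bad, P {ω | ∀ i, 1 ≤ (N ω ∩ (g ⁻¹' {c.1 i} ∩ L)).encard} :=
          measure_iUnion_le _
      _ ≤ ∑' c : Bad, Measure.pi (fun _ => ν) (Set.univ.pi fun i => g ⁻¹' {c.1 i}) := by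
        refine ENNReal.tsum_le_tsum fun c => ?_
        simp only [Measure.pi_pi, hνcell]
        refine hN.measure_forall_one_le_encard_le (fun i => hcellL _) (fun i => hfin _) ?_
        exact fun i j hij => (hdisj _ _ (c.2.1.ne hij)).mono Set.inter_subset_left
          Set.inter_subset_left
      _ = Measure.pi (fun _ => ν) (⋃ c : Bad, Set.univ.pi fun i => g ⁻¹' {c.1 i}) := by
        refine (measure_iUnion (fun c c' hcc => ?_)
          fun c => MeasurableSet.univ_pi fun i => hcell _).symm
        refine Set.disjoint_left.2 fun z hz hz' => hcc (Subtype.ext (funext fun i => ?_))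
        exact (hz i trivial : g (z i) = c.1 i).symm.trans (hz' i trivial)
      _ ≤ _ := by
        refine measure_mono (Set.iUnion_subset fun c z hz => ?_)
        obtain ⟨z', hz'F, hz'⟩ := c.2.2
        refine Metric.mem_cthickening_of_dist_le z z' r _ hz'F ?_
        exact (dist_pi_le_iff hr.le).2 fun i =>
          (hgr _ _ ((hz i trivial : g (z i) = c.1 i).trans (hz' i).symm)).le

/-- **First moment bound.** The probability that some `k` distinct points of the process in `L`
form a tuple of the closed set `F` is at most the mass of `F` for the `k`-th power of the
intensity on `L`. -/
theorem measure_exists_tuple_le (hN : IsPoissonPointProcess N μ P) [NullSingletonClass μ] {L : Set X}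
    (hL : MeasurableSet L) (hμL : μ L ≠ ⊤) {k : ℕ} {F : Set (Fin k → X)} (hF : IsClosed F) :
    P {ω | ∃ z : Fin k → X, z.Injective ∧ (∀ i, z i ∈ N ω ∩ L) ∧ z ∈ F} ≤
      Measure.pi (fun _ => μ.restrict L) F := by
  have : IsFiniteMeasure (μ.restrict L) := isFiniteMeasure_restrict.2 hμL
  have h := (tendsto_measure_cthickening_diagonal (μ.restrict L)).add
    (tendsto_measure_cthickening_of_isClosed (μ := Measure.pi fun _ : Fin k => μ.restrict L)
      (s := F) ⟨1, one_pos, measure_ne_top _ _⟩ hF)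
  rw [zero_add] at h
  refine ge_of_tendsto (h.mono_left nhdsWithin_le_nhds : Tendsto _ (𝓝[>] (0 : ℝ)) _) ?_
  filter_upwards [self_mem_nhdsWithin] with r hr
  exact hN.measure_exists_tuple_le_cthickening hL hμL F hr

end IsPoissonPointProcess

/-- Fubini's criterion for null sets of a finite product, with slices along the first coordinate. -/
lemma measure_pi_eq_zero_of_cons {X : Type*} [MeasurableSpace X] (ν : Measure X) [SigmaFinite ν]
    {k : ℕ} {F : Set (Fin (k + 1) → X)} (hF : MeasurableSet F)
    (h : ∀ z : Fin k → X, ν {w | (Fin.cons w z : Fin (k + 1) → X) ∈ F} = 0) :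
    Measure.pi (fun _ => ν) F = 0 := by
  have hmp := (measurePreserving_piFinSuccAbove (fun _ : Fin (k + 1) => ν) 0).symm
  rw [← hmp.measure_preimage hF.nullMeasurableSet,
    Measure.prod_apply_symm (hmp.measurable hF)]
  refine (lintegral_congr fun z => ?_).trans lintegral_zero
  rw [← h z]
  congr 1
  ext w
  simp [MeasurableEquiv.piFinSuccAbove, Fin.insertNthEquiv]

namespace HalfSpace

variable {d : ℕ}

/-! ### Comparing hyperbolic distances -/

/-- The quantity `(‖x - x'‖ ^ 2 + (y - y') ^ 2) / (y y')`, that is `4 sinh² (δ / 2)` where `δ` is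
the hyperbolic distance. It orders pairs of points as the hyperbolic distance does, and it is a
rational function of the coordinates. -/
noncomputable def distRatio (z w : HalfSpace d) : ℝ :=
  (‖z.abscissa - w.abscissa‖ ^ 2 + (z.ordinate - w.ordinate) ^ 2) / (z.ordinate * w.ordinate)

lemma ordinate_pos (z : HalfSpace d) : 0 < z.ordinate := z.2

lemma distRatio_nonneg (z w : HalfSpace d) : 0 ≤ distRatio z w := by
  have := z.ordinate_pos
  have := w.ordinate_pos
  unfold distRatio
  positivity

lemma distRatio_self (z : HalfSpace d) : distRatio z z = 0 := by simp [distRatio]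

lemma hypDist_eq_distRatio (z w : HalfSpace d) :
    hypDist z w = 2 * Real.arsinh (√(distRatio z w) / 2) := by
  rw [hypDist, distRatio, Real.sqrt_div (by positivity)]
  ring_nf

lemma hypDist_lt_hypDist_iff (z w z' w' : HalfSpace d) :
    hypDist z w < hypDist z' w' ↔ distRatio z w < distRatio z' w' := by
  rw [hypDist_eq_distRatio, hypDist_eq_distRatio, mul_lt_mul_iff_right₀ two_pos,
    Real.arsinh_lt_arsinh, div_lt_div_iff_of_pos_right two_pos,
    Real.sqrt_lt_sqrt_iff (distRatio_nonneg _ _)]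

@[fun_prop]
lemma continuous_abscissa : Continuous (abscissa : HalfSpace d → _) := by
  unfold abscissa; fun_prop

@[fun_prop]
lemma continuous_ordinate : Continuous (ordinate : HalfSpace d → ℝ) := by
  unfold ordinate; fun_prop

@[fun_prop]
lemma _root_.Continuous.distRatio {Y : Type*} [TopologicalSpace Y] {f g : Y → HalfSpace d}
    (hf : Continuous f) (hg : Continuous g) : Continuous fun y => distRatio (f y) (g y) := by
  unfold HalfSpace.distRatio
  refine Continuous.div (by fun_prop) (by fun_prop) fun y => ?_
  exact (mul_pos (f y).ordinate_pos (g y).ordinate_pos).ne'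

/-! ### Coordinate boxes -/

/-- The points `(x, y)` with `‖x‖ ≤ r` and `a ≤ y ≤ b`. -/
def box (d : ℕ) (r a b : ℝ) : Set (HalfSpace d) :=
  {z | ‖z.abscissa‖ ≤ r ∧ a ≤ z.ordinate ∧ z.ordinate ≤ b}

lemma isCompact_box {r a b : ℝ} (ha : 0 < a) : IsCompact (box d r a b) := by
  rw [Subtype.isCompact_iff]
  have : Subtype.val '' box d r a b = Metric.closedBall 0 r ×ˢ Set.Icc a b := by
    ext p
    constructor
    · rintro ⟨z, hz, rfl⟩
      exact ⟨mem_closedBall_zero_iff.2 hz.1, hz.2⟩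
    · rintro ⟨h1, h2⟩
      exact ⟨⟨p, ha.trans_le h2.1⟩, ⟨mem_closedBall_zero_iff.1 h1, h2⟩, rfl⟩
  rw [this]
  exact (isCompact_closedBall _ _).prod isCompact_Icc

lemma exists_subset_box {K : Set (HalfSpace d)} (hK : IsCompact K) :
    ∃ r a b : ℝ, 0 < a ∧ K ⊆ box d r a b := by
  rcases K.eq_empty_or_nonempty with rfl | hne
  · exact ⟨0, 1, 1, one_pos, Set.empty_subset _⟩
  obtain ⟨z₁, -, h₁⟩ := hK.exists_isMaxOn hne
    (continuous_abscissa (d := d)).norm.continuousOn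
  obtain ⟨z₂, -, h₂⟩ := hK.exists_isMinOn hne (continuous_ordinate (d := d)).continuousOn
  obtain ⟨z₃, -, h₃⟩ := hK.exists_isMaxOn hne (continuous_ordinate (d := d)).continuousOn
  exact ⟨_, _, _, z₂.ordinate_pos, fun z hz => ⟨h₁ hz, h₂ hz, h₃ hz⟩⟩

/-- Hyperbolic balls of bounded radius with centres in a box stay in a larger box. -/
lemma exists_box_of_distRatio_le {r a b R : ℝ} (ha : 0 < a) (hR : 0 ≤ R) :
    ∃ r' a' b' : ℝ, 0 < a' ∧
      ∀ z ∈ box d r a b, ∀ w, distRatio z w ≤ R → w ∈ box d r' a' b' := by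
  refine ⟨r + √(R * (b * ((R + 2) * b))), a / (R + 2), (R + 2) * b, by positivity, ?_⟩
  rintro z ⟨hz1, hz2, hz3⟩ w hw
  have hz := z.ordinate_pos
  have hw0 := w.ordinate_pos
  rw [distRatio, div_le_iff₀ (by positivity)] at hw
  have hn := sq_nonneg ‖z.abscissa - w.abscissa‖
  have h1 : w.ordinate ≤ (R + 2) * z.ordinate := by
    refine le_of_mul_le_mul_right ?_ hw0
    nlinarith
  have h2 : z.ordinate ≤ (R + 2) * w.ordinate := by
    refine le_of_mul_le_mul_right ?_ hz
    nlinarith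
  have h3 : w.ordinate ≤ (R + 2) * b :=
    h1.trans (mul_le_mul_of_nonneg_left hz3 (by linarith))
  refine ⟨?_, ?_, h3⟩
  · have h4 : ‖z.abscissa - w.abscissa‖ ≤ √(R * (b * ((R + 2) * b))) := by
      refine Real.le_sqrt_of_sq_le ?_
      have : z.ordinate * w.ordinate ≤ b * ((R + 2) * b) :=
        mul_le_mul hz3 h3 hw0.le (hz.le.trans hz3)
      nlinarith [mul_le_mul_of_nonneg_left this hR]
    have h5 := norm_sub_norm_le w.abscissa z.abscissa
    rw [norm_sub_rev] at h5
    linarith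
  · rw [div_le_iff₀ (by positivity)]
    linarith

/-- Balls centred at `O(h)` converge to horoballs: in a box, as soon as two ordinates differ by
`δ`, the higher of the two points is closer to `O(h)` once `h` is large. -/
lemma eventually_distRatio_originAt_lt (r a b : ℝ) {δ : ℝ} (hδ : 0 < δ) :
    ∀ᶠ h in atTop, ∀ z ∈ box d r a b, ∀ w ∈ box d r a b, z.ordinate + δ ≤ w.ordinate →
      distRatio (originAt d h) w < distRatio (originAt d h) z := by
  have hlim : Tendsto (fun h : ℝ => Real.exp h ^ 2 * δ) atTop atTop :=
    ((tendsto_pow_atTop two_ne_zero).comp Real.tendsto_exp_atTop).atTop_mul_const hδ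
  filter_upwards [hlim.eventually_gt_atTop (r ^ 2 * b + b ^ 3)] with h hh z hz w hw hzw
  have hz0 := z.ordinate_pos
  have hw0 := w.ordinate_pos
  have he := Real.exp_pos h
  have hO : (originAt d h).ordinate = Real.exp h := rfl
  have hO' : (originAt d h).abscissa = 0 := rfl
  rw [distRatio, distRatio, hO, hO', zero_sub, zero_sub, norm_neg, norm_neg,
    div_lt_div_iff₀ (by positivity) (by positivity)]
  have hX : ‖w.abscissa‖ ^ 2 ≤ r ^ 2 := pow_le_pow_left₀ (norm_nonneg _) hw.1 2
  have h1 : ‖w.abscissa‖ ^ 2 * z.ordinate ≤ r ^ 2 * b :=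
    mul_le_mul hX hz.2.2 hz0.le (sq_nonneg _)
  have h2 : 0 ≤ ‖z.abscissa‖ ^ 2 * w.ordinate := by positivity
  have h3 : z.ordinate * w.ordinate * (w.ordinate - z.ordinate) ≤ b * b * b := by
    have hb : 0 < b := hz0.trans_le hz.2.2
    exact mul_le_mul (mul_le_mul hz.2.2 hw.2.2 hw0.le hb.le) (by linarith [hw.2.2])
      (by linarith) (by positivity)
  have h4 : Real.exp h ^ 2 * δ ≤ Real.exp h ^ 2 * (w.ordinate - z.ordinate) :=
    mul_le_mul_of_nonneg_left (by linarith) (by positivity)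
  have key : (‖w.abscissa‖ ^ 2 + (Real.exp h - w.ordinate) ^ 2) * z.ordinate <
      (‖z.abscissa‖ ^ 2 + (Real.exp h - z.ordinate) ^ 2) * w.ordinate := by
    nlinarith
  nlinarith [mul_lt_mul_of_pos_left key he]

/-! ### Hyperbolic volume -/

lemma comap_volume_apply (S : Set (HalfSpace d)) :
    Measure.comap (Subtype.val : HalfSpace d → EuclideanSpace ℝ (Fin d) × ℝ) volume S =
      volume ((Subtype.val : HalfSpace d → EuclideanSpace ℝ (Fin d) × ℝ) '' S) :=
  comap_subtype_coe_apply (measurableSet_lt measurable_const measurable_snd) _ _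

lemma hypVol_lt_top_of_isCompact {L : Set (HalfSpace d)} (hL : IsCompact L) :
    hypVol d L < ⊤ := by
  have hcont : Continuous fun z : HalfSpace d => 1 / z.ordinate ^ (d + 1) :=
    continuous_const.div (by fun_prop) fun z => (pow_pos z.ordinate_pos _).ne'
  obtain ⟨C, hC⟩ := (hL.image hcont).bddAbove
  have hvol :
      Measure.comap (Subtype.val : HalfSpace d → EuclideanSpace ℝ (Fin d) × ℝ) volume L < ⊤ := by
    rw [comap_volume_apply]
    exact (hL.image continuous_subtype_val).measure_lt_top
  rw [hypVol, withDensity_apply _ hL.measurableSet]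
  calc _ ≤ ∫⁻ _ in L, ENNReal.ofReal C ∂_ := setLIntegral_mono' hL.measurableSet fun z hz =>
        ENNReal.ofReal_le_ofReal (hC (Set.mem_image_of_mem _ hz))
    _ < ⊤ := by
      rw [setLIntegral_const]
      exact ENNReal.mul_lt_top ENNReal.ofReal_lt_top hvol

/-- A set of points whose vertical slices are Lebesgue null is null. -/
lemma hypVol_preimage_eq_zero {T : Set (EuclideanSpace ℝ (Fin d) × ℝ)} (hT : MeasurableSet T)
    (h : ∀ x, volume {y | (x, y) ∈ T} = 0) : hypVol d (Subtype.val ⁻¹' T) = 0 := by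
  refine withDensity_absolutelyContinuous _ _ ?_
  rw [comap_volume_apply]
  refine measure_mono_null (Set.image_preimage_subset _ _) ?_
  exact (Measure.measure_prod_null hT).2 (Eventually.of_forall h)

lemma hypVol_ordinate_eq (t : ℝ) : hypVol d {z | z.ordinate = t} = 0 :=
  hypVol_preimage_eq_zero (T := {p | p.2 = t}) (measurableSet_eq_fun (by fun_prop) (by fun_prop))
    fun x => by simp

instance : NullSingletonClass (hypVol d) where
  measure_singleton z :=
    measure_mono_null (Set.singleton_subset_iff.2 (by simp)) (hypVol_ordinate_eq z.ordinate)

/-- Hyperbolic spheres are null. -/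
lemma hypVol_distRatio_eq (c : HalfSpace d) (t : ℝ) : hypVol d {w | distRatio c w = t} = 0 := by
  have h := hypVol_preimage_eq_zero (d := d)
    (T := {p | ‖c.abscissa - p.1‖ ^ 2 + (c.ordinate - p.2) ^ 2 = t * (c.ordinate * p.2)})
    (isClosed_eq (by fun_prop) (by fun_prop)).measurableSet fun x => ?_
  · refine measure_mono_null (fun w hw => ?_) h
    have hw : distRatio c w = t := hw
    rw [distRatio, div_eq_iff (mul_pos c.ordinate_pos w.ordinate_pos).ne'] at hw
    exact hw
  · -- The slice is the zero set of a monic quadratic polynomial, whose roots sum to `s`.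
    simp only [Set.mem_ofPred_eq]
    by_cases hne : ∃ y₁, ‖c.abscissa - x‖ ^ 2 + (c.ordinate - y₁) ^ 2 = t * (c.ordinate * y₁)
    · obtain ⟨y₁, h₁⟩ := hne
      let s := 2 * c.ordinate + t * c.ordinate
      refine Set.Finite.measure_zero (Set.Finite.subset (Set.toFinite {y₁, s - y₁}) ?_) _
      intro y hy
      have hy : ‖c.abscissa - x‖ ^ 2 + (c.ordinate - y) ^ 2 = t * (c.ordinate * y) := hy
      have : (y - y₁) * (y - (s - y₁)) = 0 := by simp only [s]; linear_combination hy - h₁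
      rcases mul_eq_zero.1 this with h | h
      · exact Or.inl (sub_eq_zero.1 h)
      · exact Or.inr (sub_eq_zero.1 h)
    · push Not at hne
      have : {y | ‖c.abscissa - x‖ ^ 2 + (c.ordinate - y) ^ 2 = t * (c.ordinate * y)} = ∅ :=
        Set.eq_empty_of_forall_notMem hne
      rw [this, measure_empty]

/-- A horizontal slab has infinite volume, since `ℝ^d` has when `d ≥ 1`. -/
lemma tendsto_hypVol_box (hd : 1 ≤ d) {b : ℝ} (hb : 0 < b) :
    Tendsto (fun n : ℕ => hypVol d (box d n b (b + 1))) atTop (𝓝 ⊤) := by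
  have hmono : Monotone fun n : ℕ => box d n b (b + 1) := fun m n hmn z hz =>
    ⟨hz.1.trans (Nat.cast_le.2 hmn), hz.2⟩
  let S : Set (HalfSpace d) := {z | b ≤ z.ordinate ∧ z.ordinate ≤ b + 1}
  have hS : MeasurableSet S :=
    ((isClosed_le continuous_const continuous_ordinate).inter
      (isClosed_le continuous_ordinate continuous_const)).measurableSet
  have hU : ⋃ n : ℕ, box d n b (b + 1) = S := by
    ext z
    refine ⟨fun h => ?_, fun h => ?_⟩
    · obtain ⟨n, hn⟩ := Set.mem_iUnion.1 h
      exact hn.2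
    · obtain ⟨n, hn⟩ := exists_nat_ge ‖z.abscissa‖
      exact Set.mem_iUnion.2 ⟨n, hn, h⟩
  have htop : hypVol d (⋃ n : ℕ, box d n b (b + 1)) = ⊤ := by
    rw [hU, hypVol, withDensity_apply _ hS, eq_top_iff]
    calc (⊤ : ENNReal)
        = ENNReal.ofReal (1 / (b + 1) ^ (d + 1)) *
            Measure.comap (Subtype.val : HalfSpace d → EuclideanSpace ℝ (Fin d) × ℝ) volume S := by
          have : Nonempty (Fin d) := ⟨⟨0, hd⟩⟩
          have himg : (Subtype.val : HalfSpace d → EuclideanSpace ℝ (Fin d) × ℝ) '' S =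
              Set.univ ×ˢ Set.Icc b (b + 1) := by
            ext p
            constructor
            · rintro ⟨z, hz, rfl⟩
              exact ⟨trivial, hz⟩
            · rintro ⟨-, h2⟩
              exact ⟨⟨p, hb.trans_le h2.1⟩, h2, rfl⟩
          rw [comap_volume_apply, himg, Measure.volume_eq_prod, Measure.prod_prod,
            measure_univ_of_isAddLeftInvariant]
          have hpos : 0 < 1 / (b + 1) ^ (d + 1) := by positivity
          simp [ENNReal.mul_top, -one_div, hpos]
      _ = ∫⁻ _ in S,
            ENNReal.ofReal (1 / (b + 1) ^ (d + 1)) ∂_ := (setLIntegral_const _ _).symm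
      _ ≤ _ := setLIntegral_mono' hS fun z hz => ENNReal.ofReal_le_ofReal
          (one_div_le_one_div_of_le (pow_pos z.ordinate_pos _)
            (pow_le_pow_left₀ z.ordinate_pos.le hz.2 _))
  rw [← htop]
  exact tendsto_measure_iUnion_atTop hmono

end HalfSpace

/-! ### Agreement of the two parents -/

namespace HalfSpace

variable {d : ℕ}

/-- The deterministic core. Let `L` contain every point closer to `z` than `u`, where `u ∈ N` lies
above `z`. If, within `L`, no other point of `N` has almost the ordinate of `z`, no two points of
`N` are equidistant from `z`, and the ball of centre `O` through `z` agrees with the half-space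
above `z` up to an error `δ` in ordinate, then the two parents of `z` exist and are equal. -/
lemma exists_common_parent {N L : Set (HalfSpace d)} {O z u : HalfSpace d} {δ : ℝ}
    (hfin : (N ∩ L).Finite) (hu : u ∈ N) (hzu : z.ordinate < u.ordinate)
    (hball : ∀ w, distRatio z w ≤ distRatio z u → w ∈ L) (hO : O ∉ L)
    (hsep : ∀ w ∈ N ∩ L, w ≠ z → δ < |z.ordinate - w.ordinate|)
    (hequi : ∀ v ∈ N ∩ L, ∀ w ∈ N ∩ L, v ≠ z → w ≠ z → v ≠ w → distRatio z v ≠ distRatio z w)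
    (hup : ∀ w ∈ L, z.ordinate + δ ≤ w.ordinate → distRatio O w < distRatio O z)
    (hdown : ∀ w ∈ L, w.ordinate + δ ≤ z.ordinate → distRatio O z < distRatio O w) :
    ∃ w, IsRSTParent N O z w ∧ IsDSFParent N z w := by
  have huL : u ∈ L := hball u le_rfl
  obtain ⟨w, ⟨⟨hwN, hwL⟩, hzw⟩, hmin⟩ :=
    Set.exists_min_image {w ∈ N ∩ L | z.ordinate < w.ordinate} (distRatio z)
      (hfin.subset (Set.sep_subset _ _)) ⟨u, ⟨hu, huL⟩, hzu⟩
  have hne : ∀ v : HalfSpace d, z.ordinate < v.ordinate → v ≠ z := by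
    rintro v hv rfl
    exact lt_irrefl _ hv
  have hwu := hmin u ⟨⟨hu, huL⟩, hzu⟩
  have hout : ∀ v, v ∉ L → distRatio z w < distRatio z v := fun v hv =>
    hwu.trans_lt (not_le.1 fun h => hv (hball v h))
  have hin : ∀ v ∈ N ∩ L, z.ordinate < v.ordinate → v ≠ w → distRatio z w < distRatio z v :=
    fun v hv hzv hvw => lt_of_le_of_ne (hmin v ⟨hv, hzv⟩)
      (hequi w ⟨hwN, hwL⟩ v hv (hne w hzw) (hne v hzv) hvw.symm)
  refine ⟨w, ⟨⟨Or.inl hwN, ?_⟩, ?_⟩, ⟨hwN, hzw⟩, ?_⟩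
  · refine (hypDist_lt_hypDist_iff _ _ _ _).2 (hup w hwL ?_)
    have h := hsep w ⟨hwN, hwL⟩ (hne w hzw)
    rw [abs_of_neg (sub_neg.2 hzw)] at h
    linarith
  · rintro v ⟨hvN, hvO⟩ hvw
    have hvO : distRatio O v < distRatio O z := (hypDist_lt_hypDist_iff _ _ _ _).1 hvO
    rw [hypDist_lt_hypDist_iff]
    by_cases hvL : v ∈ L
    · have hvN : v ∈ N := hvN.resolve_right fun h => hO (h ▸ hvL)
      have hvz : v ≠ z := by
        rintro rfl
        exact lt_irrefl _ hvO
      refine hin v ⟨hvN, hvL⟩ (not_le.1 fun hle => ?_) hvw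
      have h := hsep v ⟨hvN, hvL⟩ hvz
      rw [abs_of_nonneg (sub_nonneg.2 hle)] at h
      exact lt_asymm hvO (hdown v hvL (by linarith))
    · exact hout v hvL
  · rintro v ⟨hvN, hzv⟩ hvw
    rw [hypDist_lt_hypDist_iff]
    by_cases hvL : v ∈ L
    · exact hin v ⟨hvN, hvL⟩ hzv hvw
    · exact hout v hvL

end HalfSpace

/-! ### Exceptional configurations of the Poisson process -/

namespace IsPoissonPointProcess

open HalfSpace

variable {d : ℕ} {Ω : Type*} [MeasurableSpace Ω] {P : Measure Ω} {N : Ω → Set (HalfSpace d)}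
  {μ : Measure (HalfSpace d)}

/-- Almost surely, no point of the process in `L` is equidistant from two others. -/
lemma measure_exists_equidistant (hN : IsPoissonPointProcess N μ P) (hμ : μ ≪ hypVol d)
    {L : Set (HalfSpace d)} (hL : MeasurableSet L) (hμL : μ L ≠ ⊤) :
    P {ω | ∃ z ∈ N ω ∩ L, ∃ v ∈ N ω ∩ L, ∃ w ∈ N ω ∩ L, v ≠ z ∧ w ≠ z ∧ v ≠ w ∧
      distRatio z v = distRatio z w} = 0 := by
  have : IsFiniteMeasure (μ.restrict L) := isFiniteMeasure_restrict.2 hμL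
  have : NullSingletonClass μ := ⟨fun z => hμ (measure_singleton z)⟩
  let F : Set (Fin 3 → HalfSpace d) := {z | distRatio (z 2) (z 0) = distRatio (z 2) (z 1)}
  have hF : IsClosed F := by
    have h : ∀ i : Fin 3, Continuous fun z : Fin 3 → HalfSpace d => distRatio (z 2) (z i) :=
      fun i => (continuous_apply (2 : Fin 3)).distRatio (continuous_apply i)
    exact isClosed_eq (h 0) (h 1)
  have hF0 : Measure.pi (fun _ => μ.restrict L) F = 0 := by
    refine measure_pi_eq_zero_of_cons _ hF.measurableSet fun z => ?_
    refine Measure.restrict_le_self.absolutelyContinuous (hμ ?_)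
    exact measure_mono_null (fun w hw => hw)
      (hypVol_distRatio_eq (z 1) (distRatio (z 1) (z 0)))
  refine measure_mono_null ?_ (le_zero_iff.1 ((hN.measure_exists_tuple_le hL hμL hF).trans hF0.le))
  rintro ω ⟨z, hz, v, hv, w, hw, hvz, hwz, hvw, h⟩
  refine ⟨![v, w, z], ?_, ?_, h⟩
  · intro i j
    fin_cases i <;> fin_cases j <;> simp [hvz, hwz, hvw, hvz.symm, hwz.symm, hvw.symm]
  · intro i
    fin_cases i
    exacts [hv, hw, hz]

/-- With probability close to `1`, distinct points of the process in `L` have ordinates at least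
`δ` apart, if `δ` is small. -/
lemma exists_measure_close_ordinates_le (hN : IsPoissonPointProcess N μ P) (hμ : μ ≪ hypVol d)
    {L : Set (HalfSpace d)} (hL : MeasurableSet L) (hμL : μ L ≠ ⊤) {ε : ENNReal} (hε : 0 < ε) :
    ∃ δ : ℝ, 0 < δ ∧ P {ω | ∃ z ∈ N ω ∩ L, ∃ w ∈ N ω ∩ L, w ≠ z ∧
      |z.ordinate - w.ordinate| ≤ δ} ≤ ε := by
  have : IsFiniteMeasure (μ.restrict L) := isFiniteMeasure_restrict.2 hμL
  have : NullSingletonClass μ := ⟨fun z => hμ (measure_singleton z)⟩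
  let F : ℝ → Set (Fin 2 → HalfSpace d) := fun δ => {z | |(z 0).ordinate - (z 1).ordinate| ≤ δ}
  have hF : ∀ δ, IsClosed (F δ) := fun δ => by
    have h : ∀ i : Fin 2, Continuous fun z : Fin 2 → HalfSpace d => (z i).ordinate :=
      fun i => continuous_ordinate.comp (continuous_apply i)
    exact isClosed_le ((h 0).sub (h 1)).abs continuous_const
  have hI : Measure.pi (fun _ => μ.restrict L) (⋂ δ > (0 : ℝ), F δ) = 0 := by
    refine measure_mono_null (t := F 0) (fun z hz => ?_)
      (measure_pi_eq_zero_of_cons _ (hF 0).measurableSet fun z => ?_)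
    · exact le_of_forall_gt_imp_ge_of_dense fun δ hδ => Set.mem_iInter₂.1 hz δ hδ
    · refine Measure.restrict_le_self.absolutelyContinuous
        (hμ (measure_mono_null (fun w hw => ?_) (hypVol_ordinate_eq (z 0).ordinate)))
      have hw : |w.ordinate - (z 0).ordinate| ≤ 0 := hw
      exact sub_eq_zero.1 (abs_nonpos_iff.1 hw)
  have hlim := tendsto_measure_biInter_gt (μ := Measure.pi fun _ : Fin 2 => μ.restrict L)
    (s := F) (a := 0) (fun δ _ => (hF δ).measurableSet.nullMeasurableSet)
    (fun i j _ hij z hz => le_trans hz hij) ⟨1, one_pos, measure_ne_top _ _⟩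
  rw [hI] at hlim
  obtain ⟨δ, hδε, hδ⟩ := ((hlim.eventually_lt_const hε).and self_mem_nhdsWithin).exists
  refine ⟨δ, hδ, (measure_mono ?_).trans
    ((hN.measure_exists_tuple_le hL hμL (hF δ)).trans hδε.le)⟩
  rintro ω ⟨z, hz, w, hw, hwz, h⟩
  refine ⟨![z, w], ?_, ?_, h⟩
  · intro i j
    fin_cases i <;> fin_cases j <;> simp [hwz, hwz.symm]
  · intro i
    fin_cases i
    exacts [hz, hw]

/-- A large enough box at height above `b` contains a point of the process with probability close
to `1`. -/
lemma exists_measure_box_empty_le (hd : 1 ≤ d) {lam : ℝ} (hlam : 0 < lam)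
    (hN : IsPoissonPointProcess N (ENNReal.ofReal lam • hypVol d) P) {b : ℝ} (hb : 0 < b)
    {ε : ENNReal} (hε : 0 < ε) :
    ∃ n : ℕ, P {ω | (N ω ∩ box d n b (b + 1)).encard = 0} ≤ ε := by
  have hfin : ∀ n : ℕ, (ENNReal.ofReal lam • hypVol d) (box d n b (b + 1)) ≠ ⊤ := fun n =>
    ENNReal.mul_ne_top ENNReal.ofReal_ne_top (hypVol_lt_top_of_isCompact (isCompact_box hb)).ne
  have hlam' : ENNReal.ofReal lam ≠ 0 := by simpa using hlam
  have h1 : Tendsto (fun n : ℕ => (ENNReal.ofReal lam • hypVol d) (box d n b (b + 1)))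
      atTop (𝓝 ⊤) := by
    have h := ENNReal.Tendsto.const_mul (a := ENNReal.ofReal lam) (tendsto_hypVol_box hd hb)
      (Or.inl ENNReal.top_ne_zero)
    rwa [ENNReal.mul_top hlam'] at h
  have h2 : Tendsto (fun n : ℕ => ((ENNReal.ofReal lam • hypVol d)
      (box d n b (b + 1))).toReal) atTop atTop := by
    refine tendsto_atTop.2 fun c => ?_
    filter_upwards [h1.eventually (lt_mem_nhds (ENNReal.ofReal_lt_top (r := c)))] with n hn
    exact (ENNReal.ofReal_le_iff_le_toReal (hfin n)).1 hn.le
  have h3 := (ENNReal.continuous_ofReal.tendsto 0).comp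
    (Real.tendsto_exp_neg_atTop_nhds_zero.comp h2)
  rw [ENNReal.ofReal_zero] at h3
  obtain ⟨n, hn⟩ := (h3.eventually_lt_const hε).exists
  refine ⟨n, (hN.measure_encard_eq_zero (isCompact_box hb).measurableSet (hfin n)).trans_le hn.le⟩

/-- The box `L`, the gap `δ` and the witness box `U` are chosen before `h`, so that one exceptional
event of probability at most `ε` contains the failure event for all large `h`. -/
lemma tendsto_measure_compl_sameParents (hd : 1 ≤ d) {lam : ℝ} (hlam : 0 < lam)
    (hN : IsPoissonPointProcess N (ENNReal.ofReal lam • hypVol d) P) {K : Set (HalfSpace d)}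
    (hK : IsCompact K) : Tendsto (fun h : ℝ => P (sameParents N K h)ᶜ) atTop (𝓝 0) := by
  refine ENNReal.tendsto_nhds_zero.2 fun ε hε => ?_
  have hε2 : 0 < ε / 2 := ENNReal.half_pos hε.ne'
  have hμ : ENNReal.ofReal lam • hypVol d ≪ hypVol d := Measure.smul_absolutelyContinuous
  obtain ⟨r, a, b, ha, hKbox⟩ := exists_subset_box hK
  -- `max b a` instead of `b`: nothing forces `b` to be positive when the box is empty.
  have hb : 0 < max b a + 1 := by linarith [le_max_right b a]
  obtain ⟨n, hn⟩ := hN.exists_measure_box_empty_le hd hlam hb hε2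
  set U := box d n (max b a + 1) (max b a + 1 + 1)
  obtain ⟨R, hR⟩ := (((isCompact_box (d := d) (r := r) (b := b) ha).prod
    (isCompact_box hb : IsCompact U)).image
      (continuous_fst.distRatio continuous_snd)).bddAbove
  obtain ⟨r', a', b', ha', hL⟩ :=
    exists_box_of_distRatio_le (d := d) (r := r) (b := b) ha (le_max_right R 0)
  set L := box d r' a' b'
  have hLc : IsCompact L := isCompact_box ha'
  have hLm := hLc.measurableSet
  have hμL : (ENNReal.ofReal lam • hypVol d) L ≠ ⊤ :=
    ENNReal.mul_ne_top ENNReal.ofReal_ne_top (hypVol_lt_top_of_isCompact hLc).ne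
  obtain ⟨δ, hδ, hPδ⟩ := hN.exists_measure_close_ordinates_le hμ hLm hμL hε2
  filter_upwards [eventually_distRatio_originAt_lt r' a' b' hδ,
    Real.tendsto_exp_atTop.eventually_gt_atTop b'] with h hcmp hOb
  have hsub : (sameParents N K h)ᶜ ⊆
      ({ω | (N ω ∩ U).encard = 0} ∪ {ω | ∃ z ∈ N ω ∩ L, ∃ w ∈ N ω ∩ L, w ≠ z ∧
        |z.ordinate - w.ordinate| ≤ δ}) ∪ ({ω | (N ω ∩ L).encard = ⊤} ∪
      {ω | ∃ z ∈ N ω ∩ L, ∃ v ∈ N ω ∩ L, ∃ w ∈ N ω ∩ L, v ≠ z ∧ w ≠ z ∧ v ≠ w ∧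
        distRatio z v = distRatio z w}) := by
    refine fun ω hω => by_contra fun hgood => hω ?_
    simp only [Set.mem_union, not_or, Set.mem_ofPred_eq, Set.encard_eq_zero,
      Set.encard_eq_top_iff, Set.not_infinite] at hgood
    obtain ⟨⟨hU, hclose⟩, hfin, hequi⟩ := hgood
    obtain ⟨u, huN, huU⟩ := Set.nonempty_iff_ne_empty.2 hU
    rintro z ⟨hzN, hzK⟩
    have hzbox := hKbox hzK
    have hzL : z ∈ L := hL z hzbox z (by simp [distRatio_self])
    have hzu : z.ordinate < u.ordinate := by
      linarith [hzbox.2.2, huU.2.1, le_max_left b a]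
    have hzuR : distRatio z u ≤ max R 0 := le_max_of_le_left (hR ⟨(z, u), ⟨hzbox, huU⟩, rfl⟩)
    refine exists_common_parent (L := L) (δ := δ) hfin huN hzu
      (fun w hw => hL z hzbox w (hw.trans hzuR)) (fun hO => hOb.not_ge hO.2.2) ?_ ?_
      (fun w hw => hcmp z hzL w hw) (fun w hw => hcmp w hw z hzL)
    · exact fun w hw hwz => not_le.1 fun hle => hclose ⟨z, ⟨hzN, hzL⟩, w, hw, hwz, hle⟩
    · exact fun v hv w hw hvz hwz hvw heq =>
        hequi ⟨z, ⟨hzN, hzL⟩, v, hv, w, hw, hvz, hwz, hvw, heq⟩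
  calc P (sameParents N K h)ᶜ
      ≤ _ := (measure_mono hsub).trans ((measure_union_le _ _).trans
        (add_le_add (measure_union_le _ _) (measure_union_le _ _)))
    _ ≤ (ε / 2 + ε / 2) + (0 + 0) := by
      gcongr
      · exact (hN.measure_encard_eq_top hLm hμL).le
      · exact (hN.measure_exists_equidistant hμ hLm hμL).le
    _ = ε := by rw [ENNReal.add_halves, add_zero, add_zero]

end IsPoissonPointProcess

theorem mainTheorem6 (d : ℕ) (hd : 1 ≤ d) (lam : ℝ) (hlam : 0 < lam)
    {Ω : Type*} [MeasurableSpace Ω] (P : Measure Ω) [IsProbabilityMeasure P]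
    (N : Ω → Set (HalfSpace d))
    (hN : IsPoissonPointProcess N (ENNReal.ofReal lam • HalfSpace.hypVol d) P)
    (K : Set (HalfSpace d)) (hK : IsCompact K) :
    Tendsto (fun h : ℝ => P (sameParents N K h)) atTop (𝓝 1) ∧
      Tendsto (fun h : ℝ => P (sameParents N K h)ᶜ) atTop (𝓝 0) := by
  have h0 := hN.tendsto_measure_compl_sameParents hd hlam hK
  refine ⟨?_, h0⟩
  -- The event need not be measurable, so only subadditivity of the outer measure is available.
  have h1 : Tendsto (fun h : ℝ => 1 - P (sameParents N K h)ᶜ) atTop (𝓝 1) := by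
    simpa using ENNReal.Tendsto.sub (tendsto_const_nhds (x := (1 : ENNReal))) h0
      (Or.inl ENNReal.one_ne_top)
  refine tendsto_of_tendsto_of_tendsto_of_le_of_le h1 tendsto_const_nhds (fun h => ?_)
    fun h => prob_le_one
  refine tsub_le_iff_right.2 ?_
  rw [← measure_univ (μ := P), ← Set.union_compl_self (sameParents N K h)]
  exact measure_union_le _ _
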